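/- Let $G$ be a countable (discrete) group. For $m\ge 1$, a map $\sigma:G\to\mathrm{Sym}(m)$ (not necessarily a homomorphism), and $F\subset G$, let $V(F)\subset\{1,\dots,m\}$ be the set of all $v$ such that for all $f_1,f_2\in F$ one has $\sigma(f_1)\sigma(f_2)v=\sigma(f_1f_2)v$, and $\sigma(f_1)v\ne\sigma(f_2)v$ if $f_1\neq f_2$. The group $G$ is sofic if there are maps $\sigma_i:G\to\mathrm{Sym}(m_i)$ with $m_i\ge 1$ $(i=1,2,\dots)$, subsets $F_1\subset F_2\subset\cdots$ of $G$ with $\bigcup_i F_i=G$, and real numbers $\epsilon_i\to 0$ such that $|V(F_i)|\ge(1-\epsilon_i)m_i$ for all $i$, where $V(F_i)$ is formed with $\sigma_i$. For a standard Borel probability space $(K,\kappa)$, the entropy of $\kappa$ is $H(\kappa)=-\sum_{k\in K'}\kappa(\{k\})\log\kappa(\{k\})\in[0,\infty]$ (with $0\log 0=0$) if there is a finite or countably infinite set $K'\subset K$ with $\kappa(K')=1$, and $H(\kappa)=+\infty$ otherwise. The Bernoulli shift $(G,K^G,\kappa^G)$ is the set $K^G$ of all functions $x:G\to K$ with the product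 Borel structure and the product measure $\kappa^G$, on which $G$ acts by $(gx)(f)=x(g^{-1}f)$. Two systems $(G,X,\mu)$ and $(G,Y,\nu)$ are isomorphic if there are conull sets $X'\subset X$, $Y'\subset Y$ and a bijective measurable map $\phi:X'\to Y'$ with measurable inverse such that $\phi_*\mu=\nu$ and, for all $g\in G$ and $x\in X'$, $gx\in X'$ and $\phi(gx)=g\phi(x)$. Theorem. Let $G$ be a countable sofic group and let $(K_1,\kappa_1)$, $(K_2,\kappa_2)$ be standard Borel probability spaces such that $H(\kappa_1)+H(\kappa_2)<\infty$. If $(G,K_1^G,\kappa_1^G)$ is isomorphic to $(G,K_2^G,\kappa_2^G)$, then $H(\kappa_1)=H(\kappa_2)$. -/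

import Mathlib

open MeasureTheory

namespace SoficEntropy

/-! ### Sofic groups -/

/-- For `σ : G → Sym(m)` (not assumed to be a homomorphism) and `F ⊆ G`, the set `V(F)` of all
`v ∈ {1, …, m}` at which `σ` is multiplicative and injective along `F`. -/
def goodSet {G : Type*} [Group G] {m : ℕ} (σ : G → Equiv.Perm (Fin m)) (F : Set G) :
    Set (Fin m) :=
  {v | ∀ f₁ ∈ F, ∀ f₂ ∈ F,
    σ f₁ (σ f₂ v) = σ (f₁ * f₂) v ∧ (f₁ ≠ f₂ → σ f₁ v ≠ σ f₂ v)}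

/-- `σ : G → Sym(m)` is an `(F, ε)`-approximation to `G` if `|V(F)| ≥ (1 - ε) m`. -/
def IsApproximation {G : Type*} [Group G] {m : ℕ} (σ : G → Equiv.Perm (Fin m)) (F : Set G)
    (ε : ℝ) : Prop :=
  (1 - ε) * (m : ℝ) ≤ ((goodSet σ F).ncard : ℝ)

/-- A sequence of maps `σ i : G → Sym(m i)`, with `m i ≥ 1`, is a sofic approximation to `G` if
`σ i` is an `(F i, ε i)`-approximation to `G` for some increasing sequence `F i` of subsets of `G`
with union `G` and some `ε i → 0`. (The sets `F i` are automatically finite: as soon as `ε i < 1`,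
some point has pairwise distinct images under the maps `σ i f` with `f ∈ F i`.) -/
def IsSoficApproximation {G : Type*} [Group G] (m : ℕ → ℕ)
    (σ : (i : ℕ) → G → Equiv.Perm (Fin (m i))) : Prop :=
  (∀ i, 1 ≤ m i) ∧
    ∃ (F : ℕ → Set G) (ε : ℕ → ℝ),
      (∀ i, F i ⊆ F (i + 1)) ∧ (⋃ i, F i) = Set.univ ∧
      Filter.Tendsto ε Filter.atTop (nhds 0) ∧
      ∀ i, IsApproximation (σ i) (F i) (ε i)

/-- A group is sofic if it has a sofic approximation. -/
def IsSofic (G : Type*) [Group G] : Prop :=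
  ∃ (m : ℕ → ℕ) (σ : (i : ℕ) → G → Equiv.Perm (Fin (m i))), IsSoficApproximation m σ

/-! ### Entropy of a probability measure -/

open Classical in
/-- The entropy `H(κ)` of a probability measure: if some countable set has full measure, it is
`-∑ κ({k}) log κ({k})`, otherwise it is `∞`. The sum may be taken over all points `k`, since
points outside a countable set of full measure contribute `0` (see `baseEntropy_eq_tsum`). -/
noncomputable def baseEntropy {K : Type*} [MeasurableSpace K] (κ : Measure K) : ENNReal :=
  if ∃ K' : Set K, K'.Countable ∧ κ K' = 1 then
    ∑' k : K, ENNReal.ofReal (-(κ.real {k} * Real.log (κ.real {k})))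
  else ⊤

/-- The entropy may be computed over any countable set of full measure. -/
theorem baseEntropy_eq_tsum {K : Type*} [MeasurableSpace K] [MeasurableSingletonClass K]
    (κ : Measure K) [IsProbabilityMeasure κ] (K' : Set K) (hc : K'.Countable) (h1 : κ K' = 1) :
    baseEntropy κ = ∑' k : K', ENNReal.ofReal
      (-(κ.real {(k : K)} * Real.log (κ.real {(k : K)}))) := by
  rw [baseEntropy, if_pos ⟨K', hc, h1⟩]
  refine (tsum_subtype_eq_of_support_subset
    (f := fun k : K => ENNReal.ofReal (-(κ.real {k} * Real.log (κ.real {k}))))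
    (fun k hk => ?_)).symm
  by_contra hk'
  apply hk
  have h0 : κ {k} = 0 := by
    have hnull : κ K'ᶜ = 0 := (prob_compl_eq_zero_iff hc.measurableSet).2 h1
    exact measure_mono_null (by simpa using hk') hnull
  simp [Measure.real, h0]

/-! ### Measurable conjugacy of dynamical systems -/

/-- Two systems `(G, X, μ)` and `(G, Y, ν)` are isomorphic (measurably conjugate) if there are
conull sets `X' ⊆ X`, `Y' ⊆ Y` and a bijection `φ : X' → Y'`, measurable with measurable inverse,
with `φ_* μ = ν` and `φ (g x) = g φ(x)` for all `g ∈ G` and `x ∈ X'` (in particular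
`g x ∈ X'`). -/
def Isomorphic (G : Type*) [Group G] {X Y : Type*} [MeasurableSpace X] [MeasurableSpace Y]
    [MulAction G X] [MulAction G Y] (μ : Measure X) (ν : Measure Y) : Prop :=
  ∃ (X' : Set X) (Y' : Set Y) (φ : X' ≃ᵐ Y'),
    μ X'ᶜ = 0 ∧ ν Y'ᶜ = 0 ∧
    MeasurePreserving φ (μ.comap Subtype.val) (ν.comap Subtype.val) ∧
    ∀ (g : G) (x : X) (hx : x ∈ X'),
      ∃ hgx : g • x ∈ X', (φ ⟨g • x, hgx⟩ : Y) = g • (φ ⟨x, hx⟩ : Y)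

/-! ### Bernoulli shifts -/

/-- The space `K^G` of all functions `x : G → K`. -/
def BernoulliSpace (G K : Type*) : Type _ := G → K

/-- The product Borel structure on `K^G`. -/
instance {G K : Type*} [MeasurableSpace K] : MeasurableSpace (BernoulliSpace G K) :=
  inferInstanceAs (MeasurableSpace (G → K))

/-- The shift action `(g x)(f) = x(g⁻¹ f)` of `G` on `K^G`. -/
instance {G K : Type*} [Group G] : MulAction G (BernoulliSpace G K) where
  smul g x := fun f : G => x (g⁻¹ * f)
  one_smul x := by
    funext f
    change x ((1 : G)⁻¹ * f) = x f
    simp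
  mul_smul g h x := by
    funext f
    change x ((g * h)⁻¹ * f) = x (h⁻¹ * (g⁻¹ * f))
    simp [mul_assoc]

/-- The product measure `κ^G` on `K^G`. -/
noncomputable def bernoulliMeasure (G : Type*) {K : Type*} [MeasurableSpace K] (κ : Measure K)
    [IsProbabilityMeasure κ] : Measure (BernoulliSpace G K) :=
  Measure.infinitePi (fun _ : G => κ)

end SoficEntropy

/-!
Let `Φ` be an isomorphism from the `κ₁`-shift to the `κ₂`-shift, let `p` be a finite partition of
`K₁`, and let `σ : G → Sym(m)` be a good sofic approximation. Label the points of `{1, …, m}`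
independently with law `κ₁`. Reading `Φ` through the approximation attaches to every point `v` a
letter of a finite partition of `K₂`, whose law has entropy at most `H(κ₂)`. Conversely `Φ⁻¹` is
approximated by a code on finitely many letters, so from the whole configuration of letters one
recovers the `p`-label of each `v`, up to a correction which is rarely needed and hence of small
entropy. Counting information gives `m H(p) ≤ m (H(κ₂) + small)`, the few points at which `σ` is
not multiplicative contributing a negligible proportion. Hence `H(p) ≤ H(κ₂)`, and refining `p`
gives `H(κ₁) ≤ H(κ₂)`.
-/

namespace SoficEntropy

open Filter ProbabilityTheory
open scoped ENNReal Pointwise Topology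

section Surprisal

/-- The surprisal (information content) `-log t ∈ [0, ∞]` of an event of probability `t ≤ 1`, with
`-log 0 = ∞`; it is `0` for `t > 1`. -/
noncomputable def surprisal (t : ℝ≥0∞) : ℝ≥0∞ :=
  (-ENNReal.log t).toENNReal

theorem surprisal_antitone : Antitone surprisal := fun _ _ h =>
  EReal.toENNReal_le_toENNReal (EReal.neg_le_neg_iff.2 (ENNReal.log_monotone h))

theorem continuous_surprisal : Continuous surprisal :=
  EReal.continuous_toENNReal.comp (continuous_neg.comp ENNReal.continuous_log)

theorem surprisal_zero : surprisal 0 = ∞ := by simp [surprisal]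

theorem surprisal_one : surprisal 1 = 0 := by simp [surprisal]

theorem surprisal_eq_ofReal {t : ℝ≥0∞} (h0 : t ≠ 0) (htop : t ≠ ∞) :
    surprisal t = ENNReal.ofReal (-Real.log t.toReal) := by
  rw [surprisal, ENNReal.log_pos_real h0 htop, ← EReal.coe_neg, EReal.toENNReal_of_ne_top (by simp),
    EReal.toReal_coe]

theorem mul_surprisal {t : ℝ≥0∞} (ht : t ≠ ∞) :
    t * surprisal t = ENNReal.ofReal (Real.negMulLog t.toReal) := by
  rcases eq_or_ne t 0 with rfl | h0
  · simp
  · rw [surprisal_eq_ofReal h0 ht, Real.negMulLog, neg_mul, ← mul_neg,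
      ENNReal.ofReal_mul ENNReal.toReal_nonneg, ENNReal.ofReal_toReal ht]

theorem surprisal_mul {a b : ℝ≥0∞} (ha : a ≤ 1) (hb : b ≤ 1) :
    surprisal (a * b) = surprisal a + surprisal b := by
  have nonneg {t : ℝ≥0∞} (ht : t ≤ 1) : 0 ≤ -ENNReal.log t := by
    simpa using ENNReal.log_le_zero_iff.2 ht
  rw [surprisal, ENNReal.log_mul_add, EReal.neg_add, sub_eq_add_neg,
    EReal.toENNReal_add (nonneg ha) (nonneg hb)]
  · rfl
  · exact .inr (by simpa using (hb.trans_lt ENNReal.one_lt_top).ne)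
  · exact .inl (by simpa using (ha.trans_lt ENNReal.one_lt_top).ne)

theorem surprisal_prod {ι : Type*} (s : Finset ι) {a : ι → ℝ≥0∞} (ha : ∀ i, a i ≤ 1) :
    surprisal (∏ i ∈ s, a i) = ∑ i ∈ s, surprisal (a i) := by
  classical
  induction s using Finset.induction_on with
  | empty => simp [surprisal_one]
  | insert i s hi ih =>
    rw [Finset.prod_insert hi, Finset.sum_insert hi,
      surprisal_mul (ha i) (Finset.prod_le_one' fun j _ => ha j), ih]

/-- This is `log x ≤ x - 1` at `x = b / a`, rearranged so that no subtraction occurs. -/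
theorem mul_surprisal_add_le {a : ℝ≥0∞} (ha : a ≤ 1) (b : ℝ≥0∞) :
    a * surprisal a + a ≤ a * surprisal b + b := by
  have ha_top : a ≠ ∞ := (ha.trans_lt ENNReal.one_lt_top).ne
  rcases eq_or_ne a 0 with rfl | ha0
  · simp
  rcases eq_or_ne b 0 with rfl | hb0
  · simp [surprisal_zero, ENNReal.mul_top ha0]
  rcases eq_or_ne b ∞ with rfl | hb_top
  · simp
  have ha_pos := ENNReal.toReal_pos ha0 ha_top
  have hb_pos := ENNReal.toReal_pos hb0 hb_top
  have hlog : Real.log b.toReal - Real.log a.toReal ≤ b.toReal / a.toReal - 1 := by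
    rw [← Real.log_div hb_pos.ne' ha_pos.ne']
    exact Real.log_le_sub_one_of_pos (div_pos hb_pos ha_pos)
  have hreal : a.toReal * -Real.log a.toReal + a.toReal ≤
      a.toReal * max (-Real.log b.toReal) 0 + b.toReal := by
    have hdiv : a.toReal * (b.toReal / a.toReal - 1) = b.toReal - a.toReal := by field_simp
    have := mul_le_mul_of_nonneg_left hlog ha_pos.le
    have := mul_le_mul_of_nonneg_left (le_max_left (-Real.log b.toReal) 0) ha_pos.le
    linarith
  have hlog_nonneg : 0 ≤ -Real.log a.toReal :=
    neg_nonneg.2 (Real.log_nonpos ha_pos.le (ENNReal.toReal_mono ENNReal.one_ne_top ha))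
  rw [surprisal_eq_ofReal ha0 ha_top, surprisal_eq_ofReal hb0 hb_top]
  rw [← ENNReal.toReal_le_toReal (by finiteness) (by finiteness)]
  simpa [ENNReal.toReal_add, ENNReal.mul_ne_top, ha_top, hb_top, ENNReal.toReal_ofReal',
    hlog_nonneg] using hreal

end Surprisal

section Entropy

variable {S T : Type*} [MeasurableSpace S] [MeasurableSpace T]

/-- The entropy `-∑ ν({s}) log ν({s})` of a probability measure, written as the mean surprisal of
its points. The integrand is `∞` off the atoms of `ν`, so this is `∞` as soon as `ν` is not
carried by a countable set. The entropy of a random variable is that of its law. -/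
noncomputable def entropy (ν : Measure S) : ℝ≥0∞ :=
  ∫⁻ s, surprisal (ν {s}) ∂ν

theorem entropy_map_le (ν : Measure S) {f : S → T} (hf : Measurable f) :
    entropy (ν.map f) ≤ entropy ν :=
  (lintegral_map_le _ f).trans <| lintegral_mono fun s => surprisal_antitone <|
    (measure_mono (t := f ⁻¹' {f s}) (by simp)).trans (Measure.le_map_apply hf.aemeasurable _)

theorem entropy_map_eq_lintegral [Countable T] [MeasurableSingletonClass T] (ν : Measure S)
    {f : S → T} (hf : Measurable f) :
    entropy (ν.map f) = ∫⁻ s, surprisal (ν (f ⁻¹' {f s})) ∂ν := by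
  rw [entropy, lintegral_map (measurable_of_countable _) hf]
  simp only [Measure.map_apply hf (measurableSet_singleton _)]

variable [MeasurableSingletonClass S]

theorem entropy_dirac (s : S) : entropy (Measure.dirac s) = 0 := by
  simp [entropy, surprisal_one]

theorem baseEntropy_eq_entropy (κ : Measure S) [IsProbabilityMeasure κ] :
    baseEntropy κ = entropy κ := by
  by_cases h : ∃ K' : Set S, K'.Countable ∧ κ K' = 1
  · obtain ⟨K', hc, h1⟩ := h
    have hconull : ∀ᵐ k ∂κ, k ∈ K' := (prob_compl_eq_zero_iff hc.measurableSet).2 h1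
    rw [baseEntropy_eq_tsum κ K' hc h1, entropy, ← Measure.restrict_eq_self_of_ae_mem hconull,
      lintegral_countable _ hc, Measure.restrict_eq_self_of_ae_mem hconull]
    refine tsum_congr fun k => ?_
    rw [mul_comm (surprisal _), mul_surprisal (measure_ne_top _ _), Real.negMulLog, neg_mul]
    rfl
  · have hcount : {k | 0 < κ {k}}.Countable :=
      Measure.countable_meas_pos_of_disjoint_iUnion (fun k => measurableSet_singleton k)
        fun _ _ hne => Set.disjoint_singleton.2 hne
    have hdiffuse : κ {k | 0 < κ {k}}ᶜ ≠ 0 := fun h0 =>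
      h ⟨_, hcount, (prob_compl_eq_zero_iff hcount.measurableSet).1 h0⟩
    rw [baseEntropy, if_neg h, eq_comm, eq_top_iff, entropy]
    calc ∞ = ∫⁻ _ in {k | 0 < κ {k}}ᶜ, ∞ ∂κ := by simp [ENNReal.top_mul hdiffuse]
      _ = ∫⁻ k in {k | 0 < κ {k}}ᶜ, surprisal (κ {k}) ∂κ :=
        setLIntegral_congr_fun hcount.measurableSet.compl fun k hk => by
          have hk0 : κ {k} = 0 := by simpa using hk
          rw [hk0, surprisal_zero]
      _ ≤ _ := setLIntegral_le_lintegral _ _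

/-- The partitions into fibres of the `p n` separate points in the limit, so their surprisals
increase to that of a point, and Fatou's lemma applies. -/
theorem entropy_le_of_forall_map_le [MeasurableSpace.CountablySeparated T] (ν : Measure T)
    [IsFiniteMeasure ν] {c : ℝ≥0∞}
    (h : ∀ (n : ℕ) (p : T → Fin n → Bool), Measurable p → entropy (ν.map p) ≤ c) :
    entropy ν ≤ c := by
  have := MeasurableSpace.measurableSingletonClass_of_countablySeparated (α := T)
  obtain ⟨f, hf, hinj⟩ := MeasurableSpace.measurable_injection_nat_bool_of_countablySeparated T
  let p (n : ℕ) (t : T) (i : Fin n) : Bool := f t i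
  have hp n : Measurable (p n) := by fun_prop
  have hfiber n t : MeasurableSet (p n ⁻¹' {p n t}) := hp n (measurableSet_singleton _)
  have hanti t : Antitone fun n => p n ⁻¹' {p n t} := fun m n hmn u hu =>
    funext fun i => congrFun hu (Fin.castLE hmn i)
  have hinter t : ⋂ n, p n ⁻¹' {p n t} = {t} := by
    refine Set.Subset.antisymm (fun u hu => hinj (funext fun i => ?_)) (by simp)
    exact congrFun (Set.mem_iInter.1 hu (i + 1)) (Fin.last i)
  have hlim t : Tendsto (fun n => surprisal (ν (p n ⁻¹' {p n t}))) atTop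
      (𝓝 (surprisal (ν {t}))) := by
    rw [← hinter t]
    exact (continuous_surprisal.tendsto _).comp (tendsto_measure_iInter_atTop
      (fun n => (hfiber n t).nullMeasurableSet) (hanti t) ⟨0, measure_ne_top _ _⟩)
  calc entropy ν = ∫⁻ t, liminf (fun n => surprisal (ν (p n ⁻¹' {p n t}))) atTop ∂ν :=
        lintegral_congr fun t => (hlim t).liminf_eq.symm
    _ ≤ liminf (fun n => ∫⁻ t, surprisal (ν (p n ⁻¹' {p n t})) ∂ν) atTop :=
        lintegral_liminf_le fun n =>
          (measurable_of_countable fun z => surprisal (ν (p n ⁻¹' {z}))).comp (hp n)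
    _ ≤ c := by
        simp only [← entropy_map_eq_lintegral ν (hp _)]
        exact liminf_le_of_le (by isBoundedDefault) fun b hb =>
          let ⟨n, hn⟩ := hb.exists
          hn.trans (h n (p n) (hp n))

end Entropy

section Subadditivity

variable {S T : Type*} [Countable S] [MeasurableSpace S] [MeasurableSingletonClass S]

theorem tsum_measure_singleton (ν : Measure S) [IsProbabilityMeasure ν] : ∑' s, ν {s} = 1 := by
  simpa using (lintegral_countable' (μ := ν) fun _ => 1).symm

theorem entropy_le_lintegral_surprisal (ρ ν : Measure S) [IsProbabilityMeasure ρ]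
    [IsProbabilityMeasure ν] : entropy ρ ≤ ∫⁻ s, surprisal (ν {s}) ∂ρ := by
  rw [entropy, lintegral_countable', lintegral_countable']
  have h : ∑' s, (ρ {s} * surprisal (ρ {s}) + ρ {s}) ≤ ∑' s, (ρ {s} * surprisal (ν {s}) + ν {s}) :=
    ENNReal.tsum_le_tsum fun s => mul_surprisal_add_le prob_le_one _
  rw [ENNReal.tsum_add, ENNReal.tsum_add, tsum_measure_singleton, tsum_measure_singleton] at h
  simpa only [mul_comm] using (ENNReal.add_le_add_iff_right ENNReal.one_ne_top).1 h

theorem entropy_prod_le [Countable T] [MeasurableSpace T] [MeasurableSingletonClass T]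
    (ρ : Measure (S × T)) [IsProbabilityMeasure ρ] :
    entropy ρ ≤ entropy ρ.fst + entropy ρ.snd := by
  refine (entropy_le_lintegral_surprisal ρ (ρ.fst.prod ρ.snd)).trans_eq ?_
  have hsingleton (z : S × T) : surprisal ((ρ.fst.prod ρ.snd) {z}) =
      surprisal (ρ.fst {z.1}) + surprisal (ρ.snd {z.2}) := by
    rw [← Set.singleton_prod_singleton, Measure.prod_prod, surprisal_mul prob_le_one prob_le_one]
  simp_rw [hsingleton]
  rw [lintegral_add_left (measurable_of_countable _), entropy, entropy]
  simp only [Measure.fst, Measure.snd,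
    lintegral_map (measurable_of_countable _) measurable_fst,
    lintegral_map (measurable_of_countable _) measurable_snd]

variable {V : Type*} [Fintype V]

theorem lintegral_surprisal_pi (ρ : Measure (V → S)) (ν : V → Measure S)
    [∀ v, IsProbabilityMeasure (ν v)] :
    ∫⁻ s, surprisal (Measure.pi ν {s}) ∂ρ =
      ∑ v, ∫⁻ s, surprisal (ν v {s}) ∂ρ.map (Function.eval v) := by
  simp_rw [Measure.pi_singleton, surprisal_prod _ fun _ => prob_le_one]
  rw [lintegral_finsetSum _ fun v _ => measurable_of_countable _]
  refine Finset.sum_congr rfl fun v _ => ?_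
  rw [lintegral_map (measurable_of_countable _) (measurable_pi_apply v)]

theorem entropy_pi_le (ρ : Measure (V → S)) [IsProbabilityMeasure ρ] :
    entropy ρ ≤ ∑ v, entropy (ρ.map (Function.eval v)) := by
  have (v : V) : IsProbabilityMeasure (ρ.map (Function.eval v)) :=
    Measure.isProbabilityMeasure_map (measurable_pi_apply v).aemeasurable
  exact (entropy_le_lintegral_surprisal ρ (Measure.pi fun v => ρ.map (Function.eval v))).trans_eq
    (lintegral_surprisal_pi ρ _)

theorem entropy_pi (ν : V → Measure S) [∀ v, IsProbabilityMeasure (ν v)] :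
    entropy (Measure.pi ν) = ∑ v, entropy (ν v) := by
  rw [entropy, lintegral_surprisal_pi]
  simp_rw [(measurePreserving_eval ν _).map_eq, entropy]

end Subadditivity

section FiniteAlphabet

theorem abs_measureReal_map_sub_le {Ω S : Type*} [MeasurableSpace Ω] {μ : Measure Ω}
    [IsFiniteMeasure μ] [MeasurableSpace S] [MeasurableSingletonClass S] {X Z : Ω → S}
    (hX : Measurable X) (hZ : Measurable Z) (s : S) :
    |(μ.map Z).real {s} - (μ.map X).real {s}| ≤ μ.real {ω | Z ω ≠ X ω} := by
  rw [map_measureReal_apply hX (measurableSet_singleton s),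
    map_measureReal_apply hZ (measurableSet_singleton s), abs_sub_le_iff, sub_le_iff_le_add,
    sub_le_iff_le_add]
  have hsub (A B : Ω → S) : A ⁻¹' {s} ⊆ {ω | A ω ≠ B ω} ∪ B ⁻¹' {s} := fun ω hω => by
    by_cases hAB : A ω = B ω
    · exact .inr (hAB.symm.trans hω)
    · exact .inl hAB
  refine ⟨(measureReal_mono (hsub Z X)).trans (measureReal_union_le _ _), ?_⟩
  simp_rw [ne_comm (a := Z _)]
  exact (measureReal_mono (hsub X Z)).trans (measureReal_union_le _ _)

variable {S : Type*} [MeasurableSpace S] [MeasurableSingletonClass S]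

theorem entropy_eq_ofReal_sum_negMulLog [Fintype S] (ν : Measure S) [IsProbabilityMeasure ν] :
    entropy ν = ENNReal.ofReal (∑ s, Real.negMulLog (ν.real {s})) := by
  rw [entropy, lintegral_fintype, ENNReal.ofReal_sum_of_nonneg fun s _ =>
    Real.negMulLog_nonneg measureReal_nonneg measureReal_le_one]
  simp_rw [mul_comm (surprisal _), mul_surprisal (measure_ne_top ν _), Measure.real]

theorem entropy_le_card [Fintype S] (ν : Measure S) [IsProbabilityMeasure ν] :
    entropy ν ≤ Fintype.card S := by
  rw [entropy, lintegral_fintype, ← Finset.card_univ, ← nsmul_one, ← Finset.sum_const]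
  refine Finset.sum_le_sum fun s _ => ?_
  have h := mul_surprisal_add_le (prob_le_one (μ := ν) (s := {s})) 1
  rw [surprisal_one, mul_zero, zero_add] at h
  rw [mul_comm]
  exact le_self_add.trans h

variable {Ω ι : Type*} [MeasurableSpace Ω] {μ : Measure Ω} [IsProbabilityMeasure μ]
  {l : Filter ι} {X : Ω → S} {Y : ι → Ω → S}

theorem tendsto_entropy_map [Finite S] (hX : Measurable X) (hY : ∀ i, Measurable (Y i))
    (h : Tendsto (fun i => μ {ω | Y i ω ≠ X ω}) l (𝓝 0)) :
    Tendsto (fun i => entropy (μ.map (Y i))) l (𝓝 (entropy (μ.map X))) := by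
  have := Fintype.ofFinite S
  have hprob (Z : Ω → S) (hZ : Measurable Z) : IsProbabilityMeasure (μ.map Z) :=
    Measure.isProbabilityMeasure_map hZ.aemeasurable
  have := hprob X hX
  have (i : ι) := hprob (Y i) (hY i)
  have hpoint (s : S) : Tendsto (fun i => (μ.map (Y i)).real {s}) l (𝓝 ((μ.map X).real {s})) := by
    refine tendsto_iff_norm_sub_tendsto_zero.2 (squeeze_zero (fun _ => norm_nonneg _)
      (fun i => abs_measureReal_map_sub_le hX (hY i) s) ?_)
    exact (ENNReal.tendsto_toReal ENNReal.zero_ne_top).comp h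
  simp_rw [entropy_eq_ofReal_sum_negMulLog]
  exact ENNReal.tendsto_ofReal (tendsto_finsetSum _ fun s _ =>
    (Real.continuous_negMulLog.tendsto _).comp (hpoint s))

end FiniteAlphabet

section BlockCode

variable {I K S T : Type*} [MeasurableSpace K]

/-- A map on `I → K` is a block code if it reads only finitely many coordinates, and each of them
only through a finite measurable partition `q` of `K`. On a Bernoulli space these are the finitary
observables, by which all finite-valued observables are approximated. -/
def IsBlockCode (f : (I → K) → T) : Prop :=
  ∃ (n : ℕ) (W : Finset I) (q : K → Fin n) (A : (W → Fin n) → T),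
    Measurable q ∧ ∀ y, f y = A fun w => q (y w)

namespace IsBlockCode

theorem of_finite [Finite S] [MeasurableSpace S] [MeasurableSingletonClass S] (W : Finset I)
    {q : K → S} (hq : Measurable q) (A : (W → S) → T) :
    IsBlockCode fun y : I → K => A fun w => q (y w) :=
  let e := Finite.equivFin S
  ⟨_, W, e ∘ q, fun s => A (e.symm ∘ s), (measurable_of_finite e).comp hq, fun y => by
    simp [Function.comp_def]⟩

theorem comp {f : (I → K) → S} (hf : IsBlockCode f) (g : S → T) : IsBlockCode (g ∘ f) := by
  obtain ⟨n, W, q, A, hq, hA⟩ := hf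
  exact ⟨n, W, q, g ∘ A, hq, fun y => congrArg g (hA y)⟩

theorem pi {ι : Type*} [Finite ι] {f : ι → (I → K) → T} (hf : ∀ i, IsBlockCode (f i)) :
    IsBlockCode fun y i => f i y := by
  classical
  have := Fintype.ofFinite ι
  choose n W q A hq hA using hf
  have hW (i : ι) (w : W i) : (w : I) ∈ Finset.univ.biUnion W :=
    Finset.mem_biUnion.2 ⟨i, Finset.mem_univ i, w.2⟩
  simp only [hA]
  exact of_finite (Finset.univ.biUnion W) (measurable_pi_lambda (fun k i => q i k) hq)
    fun s i => A i fun w => s ⟨w, hW i w⟩ i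

theorem prodMk {f : (I → K) → S} {g : (I → K) → T} (hf : IsBlockCode f) (hg : IsBlockCode g) :
    IsBlockCode fun y => (f y, g y) := by
  classical
  obtain ⟨n, W, q, A, hq, hA⟩ := hf
  obtain ⟨n', W', q', A', hq', hA'⟩ := hg
  simp only [hA, hA']
  exact of_finite (W ∪ W') (hq.prodMk hq') fun s =>
    (A fun w => (s ⟨w, Finset.mem_union_left _ w.2⟩).1,
      A' fun w => (s ⟨w, Finset.mem_union_right _ w.2⟩).2)

theorem relabel {J : Type*} {f : (I → K) → T} (hf : IsBlockCode f) (r : I → J) :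
    IsBlockCode fun y : J → K => f (y ∘ r) := by
  classical
  obtain ⟨n, W, q, A, hq, hA⟩ := hf
  simp only [hA]
  exact of_finite (W.image r) hq fun s => A fun w => s ⟨r w, Finset.mem_image_of_mem r w.2⟩

theorem measurable [MeasurableSpace T] {f : (I → K) → T} (hf : IsBlockCode f) :
    Measurable f := by
  obtain ⟨n, W, q, A, hq, hA⟩ := hf
  rw [funext hA]
  exact (measurable_of_finite A).comp (by fun_prop)

theorem exists_dependsOn {f : (I → K) → T} (hf : IsBlockCode f) :
    ∃ E : Finset I, DependsOn f E := by
  obtain ⟨n, W, q, A, -, hA⟩ := hf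
  refine ⟨W, fun x y hxy => ?_⟩
  rw [hA, hA]
  exact congrArg A (funext fun w => congrArg q (hxy w w.2))

end IsBlockCode

variable (I K) in
theorem isSetAlgebra_isBlockCode : IsSetAlgebra {C : Set (I → K) | IsBlockCode (· ∈ C)} where
  empty_mem := .of_finite ∅ (measurable_const (a := ())) fun _ => False
  compl_mem _ hC := hC.comp Not
  union_mem _ _ hC hD := (hC.prodMk hD).comp fun s => s.1 ∨ s.2

variable (I K) in
theorem generateFrom_isBlockCode :
    MeasurableSpace.generateFrom {C : Set (I → K) | IsBlockCode (· ∈ C)} =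
      MeasurableSpace.pi := by
  refine le_antisymm
    (MeasurableSpace.generateFrom_le fun C hC => measurableSet_setOfPred.2 hC.measurable)
    (iSup_le fun i => ?_)
  rintro _ ⟨Q, hQ, rfl⟩
  exact MeasurableSpace.measurableSet_generateFrom
    (.of_finite {i} (measurable_mem.2 hQ) fun s => s ⟨i, by simp⟩)

variable [Finite T] [Nonempty T] [MeasurableSpace T] [MeasurableSingletonClass T]

theorem exists_isBlockCode_measure_ne_le (μ : Measure (I → K)) [IsFiniteMeasure μ]
    {f : (I → K) → T} (hf : Measurable f) {ε : ℝ≥0∞} (hε : ε ≠ 0) :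
    ∃ f' : (I → K) → T, IsBlockCode f' ∧ μ {y | f' y ≠ f y} ≤ ε := by
  have hdense := Measure.MeasureDense.of_generateFrom_isSetAlgebra_finite (μ := μ)
    (isSetAlgebra_isBlockCode I K) (generateFrom_isBlockCode I K).symm
  obtain ⟨δ, hδ, hsum⟩ := ENNReal.exists_pos_sum_of_countable hε T
  choose C hC hμC using fun t => hdense.approx (f ⁻¹' {t}) (hf (measurableSet_singleton t))
    (measure_ne_top _ _) (δ t) (hδ t)
  let decode : (T → Prop) → T := Function.invFun fun t s => s = t
  have hdecode (t : T) : decode (fun s => s = t) = t :=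
    Function.leftInverse_invFun (fun a b h => by simpa using congrFun h a) t
  have hsub : {y | decode (fun t => y ∈ C t) ≠ f y} ⊆ ⋃ t, symmDiff (f ⁻¹' {t}) (C t) := by
    intro y hy
    by_contra hn
    have hiff (t : T) : y ∈ C t ↔ t = f y := by
      simp only [Set.mem_iUnion, not_exists, Set.mem_symmDiff, Set.mem_preimage,
        Set.mem_singleton_iff] at hn
      grind
    exact hy (by simp only [hiff, hdecode])
  refine ⟨fun y => decode fun t => y ∈ C t, (IsBlockCode.pi hC).comp decode, ?_⟩
  calc μ {y | decode (fun t => y ∈ C t) ≠ f y}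
      ≤ ∑' t, μ (symmDiff (f ⁻¹' {t}) (C t)) :=
        (measure_mono hsub).trans (measure_iUnion_le _)
    _ ≤ ∑' t, (δ t : ℝ≥0∞) := ENNReal.tsum_le_tsum fun t => by simpa using (hμC t).le
    _ ≤ ε := hsum.le

theorem exists_seq_isBlockCode_tendsto (μ : Measure (I → K)) [IsFiniteMeasure μ]
    {f : (I → K) → T} (hf : Measurable f) :
    ∃ F : ℕ → (I → K) → T, (∀ j, IsBlockCode (F j)) ∧
      Tendsto (fun j => μ {y | F j y ≠ f y}) atTop (𝓝 0) := by
  have hpos (j : ℕ) : (j : ℝ≥0∞)⁻¹ ≠ 0 := ENNReal.inv_ne_zero.2 (ENNReal.natCast_ne_top j)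
  choose F hF hμF using fun j => exists_isBlockCode_measure_ne_le μ hf (hpos j)
  exact ⟨F, hF, tendsto_of_tendsto_of_tendsto_of_le_of_le tendsto_const_nhds
    ENNReal.tendsto_inv_nat_nhds_zero (fun _ => zero_le) hμF⟩

end BlockCode

section InfiniteProducts

variable {I J K S : Type*} [MeasurableSpace K] (κ : Measure K) [IsProbabilityMeasure κ]

theorem infinitePi_map_comp_injective {r : J → I} (hr : Function.Injective r) :
    (Measure.infinitePi fun _ : I => κ).map (fun x j => x (r j)) =
      Measure.infinitePi fun _ : J => κ := by
  have hindep : iIndepFun (fun j (x : I → K) => x (r j)) (Measure.infinitePi fun _ : I => κ) :=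
    (iIndepFun_infinitePi (X := fun _ => id) fun _ => measurable_id).precomp hr
  rw [(iIndepFun_iff_map_fun_eq_infinitePi_map (by fun_prop)).1 hindep]
  simp only [Measure.infinitePi_map_eval]

theorem map_comp_eq_of_dependsOn [MeasurableSpace S] {E : Finset J} {D : (J → K) → S}
    (hD : Measurable D) (hE : DependsOn D E) {r : J → I} (hr : Set.InjOn r E) :
    (Measure.infinitePi fun _ : I => κ).map (fun ω => D fun j => ω (r j)) =
      (Measure.infinitePi fun _ : J => κ).map D := by
  classical
  obtain ⟨x₀⟩ : Nonempty (J → K) := nonempty_of_isProbabilityMeasure (Measure.infinitePi fun _ => κ)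
  have hext (x : J → K) : D x = D (Function.updateFinset x₀ E fun j => x j) :=
    hE fun j hj => by simp [Function.updateFinset, Finset.mem_coe.1 hj]
  have hD' : Measurable fun z => D (Function.updateFinset x₀ E z) :=
    hD.comp measurable_updateFinset
  calc (Measure.infinitePi fun _ : I => κ).map (fun ω => D fun j => ω (r j))
      = ((Measure.infinitePi fun _ : I => κ).map fun ω (e : E) => ω (r e)).map
          fun z => D (Function.updateFinset x₀ E z) := by
        rw [Measure.map_map hD' (by fun_prop)]
        exact congrArg (Measure.map · _) (funext fun ω => hext _)
    _ = ((Measure.infinitePi fun _ : J => κ).map fun x (e : E) => x e).map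
          fun z => D (Function.updateFinset x₀ E z) := by
        rw [infinitePi_map_comp_injective κ (r := fun e : E => r e) hr.injective,
          infinitePi_map_comp_injective κ Subtype.val_injective]
    _ = (Measure.infinitePi fun _ : J => κ).map D := by
        rw [Measure.map_map hD' (by fun_prop)]
        exact congrArg (Measure.map · _) (funext fun x => (hext x).symm)

end InfiniteProducts

local instance {T : Type*} : MeasurableSpace (Option T) := ⊤

local instance {T : Type*} : DiscreteMeasurableSpace (Option T) := ⟨fun _ => trivial⟩

section Correction

variable {S T : Type*}

open Classical in
/-- The information needed to recover `t` from a guess `s`: nothing if the guess is right, and `t`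
itself otherwise. -/
noncomputable def correction (s t : T) : Option T :=
  if s = t then none else some t

theorem correction_eq_none_iff {s t : T} : correction s t = none ↔ s = t := by
  simp [correction]

theorem getD_correction (s t : T) : (correction s t).getD s = t := by
  unfold correction
  split_ifs with h
  exacts [h, rfl]

variable {Ω V : Type*} [Fintype V] [MeasurableSpace Ω] {μ : Measure Ω} [IsProbabilityMeasure μ]
  [Countable S] [MeasurableSpace S] [MeasurableSingletonClass S]
  [MeasurableSpace T] [MeasurableSingletonClass T]

theorem measurable_correction [Countable T] {X Y : Ω → T} (hX : Measurable X) (hY : Measurable Y) :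
    Measurable fun ω => correction (X ω) (Y ω) :=
  (measurable_of_countable fun z : T × T => correction z.1 z.2).comp (hX.prodMk hY)

theorem tendsto_entropy_map_correction [Finite T] {ι : Type*} {l : Filter ι} {X : ι → Ω → T}
    {Y : Ω → T} (hX : ∀ i, Measurable (X i)) (hY : Measurable Y)
    (h : Tendsto (fun i => μ {ω | X i ω ≠ Y ω}) l (𝓝 0)) :
    Tendsto (fun i => entropy (μ.map fun ω => correction (X i ω) (Y ω))) l (𝓝 0) := by
  have hzero : entropy (μ.map fun _ => (none : Option T)) = 0 := by simp [entropy_dirac]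
  rw [← hzero]
  refine tendsto_entropy_map measurable_const (fun i => measurable_correction (hX i) hY) ?_
  simpa only [ne_eq, correction_eq_none_iff] using h

theorem entropy_map_le_sum_add_correction [Countable T] {X : Ω → V → S} {Y : Ω → V → T}
    (hX : Measurable X) (hY : Measurable Y) (A : V → (V → S) → T) :
    entropy (μ.map Y) ≤ ∑ v, (entropy (μ.map fun ω => X ω v) +
      entropy (μ.map fun ω => correction (A v (X ω)) (Y ω v))) := by
  let Z (ω : Ω) (v : V) : S × Option T := (X ω v, correction (A v (X ω)) (Y ω v))
  let decode (z : V → S × Option T) (v : V) : T := (z v).2.getD (A v fun w => (z w).1)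
  have hYZ : Y = decode ∘ Z := funext₂ fun ω v => (getD_correction _ _).symm
  have hXv (v : V) : Measurable fun ω => X ω v := (measurable_pi_apply v).comp hX
  have hcorr (v : V) : Measurable fun ω => correction (A v (X ω)) (Y ω v) :=
    measurable_correction ((measurable_of_countable (A v)).comp hX)
      ((measurable_pi_apply v).comp hY)
  have hZ : Measurable Z := measurable_pi_lambda _ fun v => (hXv v).prodMk (hcorr v)
  have := Measure.isProbabilityMeasure_map (μ := μ) hZ.aemeasurable
  calc entropy (μ.map Y) = entropy ((μ.map Z).map decode) := by
        rw [Measure.map_map (measurable_of_countable _) hZ, hYZ]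
    _ ≤ entropy (μ.map Z) := entropy_map_le _ (measurable_of_countable _)
    _ ≤ ∑ v, entropy ((μ.map Z).map (Function.eval v)) := entropy_pi_le _
    _ ≤ _ := Finset.sum_le_sum fun v _ => ?_
  rw [Measure.map_map (measurable_pi_apply v) hZ]
  have := Measure.isProbabilityMeasure_map (μ := μ) ((measurable_pi_apply v).comp hZ).aemeasurable
  refine (entropy_prod_le _).trans_eq ?_
  rw [Measure.fst, Measure.snd, Measure.map_map measurable_fst ((measurable_pi_apply v).comp hZ),
    Measure.map_map measurable_snd ((measurable_pi_apply v).comp hZ)]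
  rfl

end Correction

section Models

variable {G K : Type*} [Group G]

theorem goodSet_antitone {m : ℕ} (σ : G → Equiv.Perm (Fin m)) : Antitone (goodSet σ) :=
  fun _ _ h _ hv f₁ h₁ f₂ h₂ => hv f₁ (h h₁) f₂ (h h₂)

theorem IsApproximation.ncard_compl_goodSet_le {m : ℕ} {σ : G → Equiv.Perm (Fin m)} {F : Set G}
    {ε : ℝ} (h : IsApproximation σ F ε) :
    ((goodSet σ F)ᶜ.ncard : ℝ≥0∞) ≤ ENNReal.ofReal ε * m := by
  have hadd : ((goodSet σ F).ncard : ℝ) + (goodSet σ F)ᶜ.ncard = m := by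
    exact_mod_cast (Set.ncard_add_ncard_compl (goodSet σ F)).trans (Nat.card_fin m)
  rw [← ENNReal.ofReal_natCast, ← ENNReal.ofReal_natCast, ← ENNReal.ofReal_mul' (by positivity)]
  refine ENNReal.ofReal_le_ofReal ?_
  unfold IsApproximation at h
  linarith

namespace IsSoficApproximation

variable {m : ℕ → ℕ} {σ : (i : ℕ) → G → Equiv.Perm (Fin (m i))}

theorem tendsto_ncard_compl_goodSet (hσ : IsSoficApproximation m σ) (E : Finset G) :
    Tendsto (fun i => ((goodSet (σ i) E)ᶜ.ncard : ℝ≥0∞) / m i) atTop (𝓝 0) := by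
  obtain ⟨-, F, ε, hF, hunion, hε, happ⟩ := hσ
  have hE : ∀ᶠ i in atTop, (E : Set G) ⊆ F i := by
    refine (Filter.eventually_all_finset E).2 fun g _ => ?_
    obtain ⟨i, hi⟩ := Set.mem_iUnion.1 (hunion ▸ Set.mem_univ g)
    exact eventually_atTop.2 ⟨i, fun j hj => monotone_nat_of_le_succ hF hj hi⟩
  have hε' : Tendsto (fun i => ENNReal.ofReal (ε i)) atTop (𝓝 0) := by
    simpa using ENNReal.tendsto_ofReal hε
  refine tendsto_of_tendsto_of_tendsto_of_le_of_le' tendsto_const_nhds hε'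
    (.of_forall fun _ => zero_le) ?_
  filter_upwards [hE] with i hi
  refine ENNReal.div_le_of_le_mul (le_trans ?_ (happ i).ncard_compl_goodSet_le)
  exact_mod_cast Set.ncard_le_ncard (Set.compl_subset_compl.2 (goodSet_antitone _ hi))

theorem le_of_average_le (hσ : IsSoficApproximation m σ) (E : Finset G) {a c M : ℝ≥0∞}
    (hM : M ≠ ∞) (t : (i : ℕ) → Fin (m i) → ℝ≥0∞) (hc : ∀ i, m i * c ≤ ∑ v, t i v)
    (hgood : ∀ i, ∀ v ∈ goodSet (σ i) E, t i v ≤ a) (hbad : ∀ i v, t i v ≤ M) : c ≤ a := by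
  classical
  have hle (i : ℕ) : c ≤ a + (goodSet (σ i) E)ᶜ.ncard / m i * M := by
    have hm0 : (m i : ℝ≥0∞) ≠ 0 := by exact_mod_cast Nat.one_le_iff_ne_zero.1 (hσ.1 i)
    refine (ENNReal.mul_le_mul_iff_right hm0 (by finiteness)).1 ?_
    calc m i * c ≤ ∑ v, t i v := hc i
      _ ≤ ∑ v, (a + if v ∈ (goodSet (σ i) E)ᶜ then M else 0) :=
          Finset.sum_le_sum fun v _ => by
            split_ifs with hv
            · exact (hbad i v).trans le_add_self
            · simpa using hgood i v (not_not.1 hv)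
      _ = m i * a + (goodSet (σ i) E)ᶜ.ncard * M := by
          rw [Finset.sum_add_distrib, ← Finset.sum_filter, Set.filter_mem_univ_eq_toFinset]
          simp [Set.ncard_eq_toFinset_card']
      _ = _ := by rw [mul_add, ← mul_assoc, ENNReal.mul_div_cancel hm0 (by finiteness)]
  refine ge_of_tendsto' (f := fun i => a + (goodSet (σ i) E)ᶜ.ncard / m i * M) (x := atTop) ?_ hle
  simpa using (ENNReal.Tendsto.mul_const (hσ.tendsto_ncard_compl_goodSet E) (.inr hM)).const_add a

end IsSoficApproximation

section Pullback

variable {m : ℕ} {σ : G → Equiv.Perm (Fin m)} {v : Fin m}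

/-- The pullback to `G` of a labelling `ω` of `{1, …, m}` along `g ↦ σ(g⁻¹) v`. The inverse makes
it compatible with the shift: at good points, `pullback σ (σ g v) ω` is locally `g` times
`pullback σ v ω`. -/
def pullback (σ : G → Equiv.Perm (Fin m)) (v : Fin m) (ω : Fin m → K) : BernoulliSpace G K :=
  fun g => ω (σ g⁻¹ v)

theorem pullback_one {F : Set G} (hv : v ∈ goodSet σ F) (h1 : 1 ∈ F) (ω : Fin m → K) :
    pullback σ v ω 1 = ω v := by
  have hσ : σ 1 (σ 1 v) = σ 1 v := by simpa using (hv 1 h1 1 h1).1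
  rw [pullback, inv_one, (σ 1).injective hσ]

theorem pullback_apply_perm {F : Set G} (hv : v ∈ goodSet σ F) {g h : G} (hg : g ∈ F)
    (hh : h⁻¹ ∈ F) (ω : Fin m → K) :
    pullback σ (σ g v) ω h = (g • pullback σ v ω) h := by
  change ω (σ h⁻¹ (σ g v)) = ω (σ (g⁻¹ * h)⁻¹ v)
  rw [(hv h⁻¹ hh g hg).1, mul_inv_rev, inv_inv]

theorem apply_pullback_perm {S : Type*} {F : Set G} (hv : v ∈ goodSet σ F)
    {b : BernoulliSpace G K → S} {E : Finset G} (hb : DependsOn b E) (hE : ∀ h ∈ E, h⁻¹ ∈ F)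
    {g : G} (hg : g ∈ F) (ω : Fin m → K) :
    b (pullback σ (σ g v) ω) = b (g • pullback σ v ω) :=
  hb fun h hh => pullback_apply_perm hv hg (hE h hh) ω

theorem injOn_perm_inv {F : Set G} (hv : v ∈ goodSet σ F) : Set.InjOn (fun g => σ g⁻¹ v) F⁻¹ :=
  fun g hg h hh hgh => by
    by_contra hne
    exact (hv g⁻¹ hg h⁻¹ hh).2 (inv_injective.ne hne) hgh

theorem measurable_pullback [MeasurableSpace K] :
    Measurable (pullback σ v : (Fin m → K) → BernoulliSpace G K) :=
  measurable_pi_lambda _ fun _ => measurable_pi_apply _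

end Pullback

section BernoulliMeasure

variable [MeasurableSpace K] (κ : Measure K) [IsProbabilityMeasure κ]

instance : IsProbabilityMeasure (bernoulliMeasure G κ) :=
  inferInstanceAs (IsProbabilityMeasure (Measure.infinitePi fun _ : G => κ))

theorem measurePreserving_smul_bernoulliMeasure (g : G) :
    MeasurePreserving (g • · : BernoulliSpace G K → BernoulliSpace G K) (bernoulliMeasure G κ)
      (bernoulliMeasure G κ) :=
  ⟨measurable_pi_lambda _ fun _ => measurable_pi_apply _,
    infinitePi_map_comp_injective κ (mul_right_injective g⁻¹)⟩

theorem map_comp_pullback {S : Type*} [MeasurableSpace S] {m : ℕ} {σ : G → Equiv.Perm (Fin m)}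
    {v : Fin m} {F : Set G} (hv : v ∈ goodSet σ F) {D : BernoulliSpace G K → S}
    (hD : Measurable D) {E : Finset G} (hDE : DependsOn D E) (hE : ∀ g ∈ E, g⁻¹ ∈ F) :
    (Measure.infinitePi fun _ : Fin m => κ).map (fun ω => D (pullback σ v ω)) =
      (bernoulliMeasure G κ).map D :=
  map_comp_eq_of_dependsOn κ hD hDE ((injOn_perm_inv hv).mono hE)

theorem entropy_map_infinitePi {V T : Type*} [Fintype V] [Countable T] [MeasurableSpace T]
    [MeasurableSingletonClass T] {p : K → T} (hp : Measurable p) :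
    entropy ((Measure.infinitePi fun _ : V => κ).map fun ω v => p (ω v)) =
      Fintype.card V * entropy (κ.map p) := by
  have := Measure.isProbabilityMeasure_map (μ := κ) hp.aemeasurable
  rw [Measure.infinitePi_map_pi _ (fun _ => hp), Measure.infinitePi_eq_pi, entropy_pi]
  simp

end BernoulliMeasure

end Models

section Decoding

variable {G K S T ι : Type*} [Group G] [MeasurableSpace K] [Finite T] [MeasurableSpace T]
  [MeasurableSingletonClass T] [Finite ι] {p : K → T} {b : BernoulliSpace G K → S}

theorem isBlockCode_correction (hp : Measurable p) (hb : IsBlockCode b) (g : ι → G)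
    (A : (ι → S) → T) :
    IsBlockCode fun x : BernoulliSpace G K => correction (A fun i => b (g i • x)) (p (x 1)) :=
  ((IsBlockCode.pi fun i => hb.relabel fun h => (g i)⁻¹ * h).prodMk
    (.of_finite {1} hp fun s => s ⟨1, by simp⟩)).comp fun z => correction (A z.1) z.2

variable (κ : Measure K) [IsProbabilityMeasure κ] [Finite S] [MeasurableSpace S]
  [MeasurableSingletonClass S]

theorem entropy_map_le_of_isBlockCode (hG : IsSofic G) (hp : Measurable p) (hb : IsBlockCode b)
    (g : ι → G) (A : (ι → S) → T) :
    entropy (κ.map p) ≤ entropy ((bernoulliMeasure G κ).map b) +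
      entropy ((bernoulliMeasure G κ).map fun x =>
        correction (A fun i => b (g i • x)) (p (x 1))) := by
  classical
  obtain ⟨m, σ, hσ⟩ := hG
  have := Fintype.ofFinite S
  have := Fintype.ofFinite T
  have := Fintype.ofFinite ι
  let D (x : BernoulliSpace G K) : Option T := correction (A fun i => b (g i • x)) (p (x 1))
  have hD : IsBlockCode D := isBlockCode_correction hp hb g A
  obtain ⟨Eb, hEb⟩ := hb.exists_dependsOn
  obtain ⟨ED, hED⟩ := hD.exists_dependsOn
  let F : Finset G := insert 1 (Finset.univ.image g ∪ (Eb ∪ ED)⁻¹)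
  have hgF i : g i ∈ F := by simp [F]
  have hEbF h (hh : h ∈ Eb) : h⁻¹ ∈ F := by simp [F, hh]
  have hEDF h (hh : h ∈ ED) : h⁻¹ ∈ F := by simp [F, hh]
  let P (i : ℕ) : Measure (Fin (m i) → K) := Measure.infinitePi fun _ => κ
  let X (i : ℕ) (ω : Fin (m i) → K) (v : Fin (m i)) : S := b (pullback (σ i) v ω)
  have hX i : Measurable (X i) :=
    measurable_pi_lambda _ fun v => hb.measurable.comp measurable_pullback
  let e (i : ℕ) (v : Fin (m i)) (ω : Fin (m i) → K) : Option T :=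
    correction (A fun j => X i ω (σ i (g j) v)) (p (ω v))
  have he i (v) (hv : v ∈ goodSet (σ i) F) : e i v = fun ω => D (pullback (σ i) v ω) := by
    funext ω
    simp only [e, D, X, apply_pullback_perm hv hEb hEbF (hgF _), pullback_one hv (by simp [F])]
  refine hσ.le_of_average_le F (M := Fintype.card S + Fintype.card (Option T)) (by finiteness)
    (fun i v => entropy ((P i).map fun ω => X i ω v) + entropy ((P i).map (e i v)))
    (fun i => ?_) (fun i v hv => ?_) (fun i v => ?_)
  · calc m i * entropy (κ.map p) = entropy ((P i).map fun ω v => p (ω v)) := by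
          rw [entropy_map_infinitePi κ hp, Fintype.card_fin]
      _ ≤ _ := entropy_map_le_sum_add_correction (hX i) (by fun_prop) fun v s =>
          A fun j => s (σ i (g j) v)
  · rw [he i v hv]
    exact (congrArg₂ (· + ·) (congrArg entropy (map_comp_pullback κ hv hb.measurable hEb hEbF))
      (congrArg entropy (map_comp_pullback κ hv hD.measurable hED hEDF))).le
  · have hXv : Measurable fun ω => X i ω v := (measurable_pi_apply v).comp (hX i)
    have hev : Measurable (e i v) := measurable_correction
      ((measurable_of_finite fun s : Fin (m i) → S => A fun j => s (σ i (g j) v)).comp (hX i))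
      (by fun_prop)
    have := Measure.isProbabilityMeasure_map (μ := P i) hXv.aemeasurable
    have := Measure.isProbabilityMeasure_map (μ := P i) hev.aemeasurable
    exact add_le_add (entropy_le_card _) (entropy_le_card _)

theorem entropy_map_le_add_correction (hG : IsSofic G) (hp : Measurable p) (hb : Measurable b)
    (g : ι → G) (A : (ι → S) → T) :
    entropy (κ.map p) ≤ entropy ((bernoulliMeasure G κ).map b) +
      entropy ((bernoulliMeasure G κ).map fun x =>
        correction (A fun i => b (g i • x)) (p (x 1))) := by
  have := Fintype.ofFinite ι
  set μ := bernoulliMeasure G κ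
  obtain ⟨x₀⟩ : Nonempty (BernoulliSpace G K) := nonempty_of_isProbabilityMeasure μ
  have : Nonempty S := ⟨b x₀⟩
  obtain ⟨B, hB, hlim⟩ : ∃ B : ℕ → BernoulliSpace G K → S, (∀ j, IsBlockCode (B j)) ∧
      Tendsto (fun j => μ {x | B j x ≠ b x}) atTop (𝓝 0) :=
    exists_seq_isBlockCode_tendsto (Measure.infinitePi fun _ : G => κ) hb
  have hcorr {b' : BernoulliSpace G K → S} (hb' : Measurable b') :
      Measurable fun x : BernoulliSpace G K => correction (A fun i => b' (g i • x)) (p (x 1)) :=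
    measurable_correction ((measurable_of_finite A).comp (measurable_pi_lambda _ fun i =>
      hb'.comp (measurePreserving_smul_bernoulliMeasure κ (g i)).measurable))
        (hp.comp (measurable_pi_apply 1))
  refine ge_of_tendsto' (x := atTop) (.add
    (tendsto_entropy_map hb (fun j => (hB j).measurable) hlim)
    (tendsto_entropy_map (hcorr hb) (fun j => hcorr (hB j).measurable) ?_))
    fun j => entropy_map_le_of_isBlockCode κ hG hp (hB j) g A
  have hsub j : {x : BernoulliSpace G K | correction (A fun i => B j (g i • x)) (p (x 1)) ≠
      correction (A fun i => b (g i • x)) (p (x 1))} ⊆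
        ⋃ i, (g i • ·) ⁻¹' {x | B j x ≠ b x} := by
    intro x hx
    by_contra hn
    simp only [Set.mem_iUnion, Set.mem_preimage, not_exists] at hn
    exact hx (by simp only [not_not.1 (hn _)])
  have hmeas j : MeasurableSet {x | B j x ≠ b x} :=
    (measurableSet_eq_fun (hB j).measurable hb).compl
  refine tendsto_of_tendsto_of_tendsto_of_le_of_le (h := fun j => ∑ _i : ι, μ {x | B j x ≠ b x})
    tendsto_const_nhds ?_ (fun _ => zero_le) fun j => ?_
  · simpa using tendsto_finsetSum Finset.univ fun (_ : ι) _ => hlim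
  · refine (measure_mono (hsub j)).trans ((measure_iUnion_fintype_le _ _).trans_eq ?_)
    exact Finset.sum_congr rfl fun i _ => (measurePreserving_smul_bernoulliMeasure κ
      (g i)).measure_preimage (hmeas j).nullMeasurableSet

end Decoding

section Isomorphism

section Conull

variable {X Y : Type*} [MeasurableSpace X] [MeasurableSpace Y] {μ : Measure X} {X' : Set X}

theorem map_val_comap_val_of_conull (hX' : μ X'ᶜ = 0) :
    (μ.comap ((↑) : X' → X)).map (↑) = μ := by
  have hnull : NullMeasurableSet X' μ := (NullMeasurableSet.of_null hX').of_compl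
  refine Measure.ext fun t ht => ?_
  rw [Measure.map_apply measurable_subtype_coe ht,
    Measure.comap_apply₀ _ _ Subtype.val_injective ?_ (measurable_subtype_coe ht).nullMeasurableSet,
    Subtype.image_preimage_coe, Set.inter_comm, measure_inter_conull hX']
  rintro _ ⟨u, hu, rfl⟩
  rw [Subtype.image_preimage_coe]
  exact hnull.inter hu.nullMeasurableSet

theorem exists_measurable_extension_of_conull [Nonempty Y] (hX' : μ X'ᶜ = 0) {φ : X' → Y}
    (hφ : Measurable φ) :
    ∃ Φ : X → Y, Measurable Φ ∧ ∀ᵐ x ∂μ, ∃ hx : x ∈ X', Φ x = φ ⟨x, hx⟩ := by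
  classical
  obtain ⟨N, hsub, hN, hμN⟩ := exists_measurable_superset_of_null hX'
  have hmem {x : X} (hx : x ∉ N) : x ∈ X' := Set.not_notMem.1 fun h => hx (hsub h)
  refine ⟨fun x => if hx : x ∈ N then Classical.arbitrary Y else φ ⟨x, hmem hx⟩,
    .dite (f := fun _ => Classical.arbitrary Y) (g := fun x : ↥Nᶜ => φ ⟨x, hmem x.2⟩)
      measurable_const (hφ.comp measurable_subtype_coe.subtype_mk) hN, ?_⟩
  filter_upwards [measure_eq_zero_iff_ae_notMem.1 hμN] with x hx
  exact ⟨hmem hx, dif_neg hx⟩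

end Conull

namespace Isomorphic

variable {G : Type*} [Group G] {X Y : Type*} [MeasurableSpace X] [MeasurableSpace Y]
  [MulAction G X] [MulAction G Y] {μ : Measure X} {ν : Measure Y}

theorem symm (h : Isomorphic G μ ν) : Isomorphic G ν μ := by
  obtain ⟨X', Y', φ, hX', hY', hφ, hequiv⟩ := h
  refine ⟨Y', X', φ.symm, hY', hX', hφ.symm φ, fun g y hy => ?_⟩
  obtain ⟨hgx, hφg⟩ := hequiv g (φ.symm ⟨y, hy⟩) (φ.symm ⟨y, hy⟩).2
  have hgy : g • y = φ ⟨_, hgx⟩ := by simp [hφg]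
  have hmem : g • y ∈ Y' := hgy ▸ (φ ⟨_, hgx⟩).2
  refine ⟨hmem, ?_⟩
  rw [show (⟨g • y, hmem⟩ : Y') = φ ⟨_, hgx⟩ from Subtype.ext hgy, φ.symm_apply_apply]

theorem exists_measurable_maps [Nonempty X] [Nonempty Y] (h : Isomorphic G μ ν)
    (hμ : ∀ g : G, MeasurePreserving (g • · : X → X) μ μ) :
    ∃ (Φ : X → Y) (Ψ : Y → X), MeasurePreserving Φ μ ν ∧ Measurable Ψ ∧
      (∀ᵐ x ∂μ, Ψ (Φ x) = x) ∧ ∀ g : G, ∀ᵐ x ∂μ, Φ (g • x) = g • Φ x := by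
  obtain ⟨X', Y', φ, hX', hY', hφ, hequiv⟩ := h
  obtain ⟨Φ, hΦ, hΦφ⟩ := exists_measurable_extension_of_conull hX'
    (measurable_subtype_coe.comp φ.measurable)
  obtain ⟨Ψ, hΨ, hΨφ⟩ := exists_measurable_extension_of_conull hY'
    (measurable_subtype_coe.comp φ.symm.measurable)
  have hΦ_preserving : MeasurePreserving Φ μ ν := by
    have hΦval : Φ ∘ (↑) =ᵐ[μ.comap ((↑) : X' → X)] (↑) ∘ φ := by
      rw [← map_val_comap_val_of_conull hX'] at hΦφ
      filter_upwards [ae_of_ae_map measurable_subtype_coe.aemeasurable hΦφ] with x ⟨_, hx⟩ using hx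
    refine ⟨hΦ, ?_⟩
    conv_lhs => rw [← map_val_comap_val_of_conull hX']
    rw [Measure.map_map hΦ measurable_subtype_coe, Measure.map_congr hΦval,
      ← Measure.map_map measurable_subtype_coe φ.measurable, hφ.map_eq,
      map_val_comap_val_of_conull hY']
  refine ⟨Φ, Ψ, hΦ_preserving, hΨ, ?_, fun g => ?_⟩
  · filter_upwards [hΦφ, hΦ_preserving.quasiMeasurePreserving.ae hΨφ] with x ⟨hx, hΦx⟩ ⟨hy, hΨx⟩
    rw [hΨx, show (⟨Φ x, hy⟩ : Y') = φ ⟨x, hx⟩ from Subtype.ext hΦx]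
    simp
  · filter_upwards [hΦφ, (hμ g).quasiMeasurePreserving.ae hΦφ] with x ⟨hx, hΦx⟩ ⟨_, hΦgx⟩
    obtain ⟨_, hφg⟩ := hequiv g x hx
    rw [hΦgx, hΦx]
    exact hφg

end Isomorphic

end Isomorphism

section Main

variable {G K₁ K₂ : Type*} [Group G] [MeasurableSpace K₁] [MeasurableSpace K₂]

theorem entropy_map_le_add_correction_of_equivariant (hG : IsSofic G) (κ₁ : Measure K₁)
    [IsProbabilityMeasure κ₁] (κ₂ : Measure K₂) [IsProbabilityMeasure κ₂]
    {Φ : BernoulliSpace G K₁ → BernoulliSpace G K₂}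
    (hΦ : MeasurePreserving Φ (bernoulliMeasure G κ₁) (bernoulliMeasure G κ₂))
    (hequiv : ∀ g : G, ∀ᵐ x ∂bernoulliMeasure G κ₁, Φ (g • x) = g • Φ x) {T : Type*} [Finite T]
    [MeasurableSpace T] [MeasurableSingletonClass T] {p : K₁ → T} (hp : Measurable p)
    {F : BernoulliSpace G K₂ → T} (hF : IsBlockCode F) :
    entropy (κ₁.map p) ≤ entropy κ₂ +
      entropy ((bernoulliMeasure G κ₁).map fun x => correction (F (Φ x)) (p (x 1))) := by
  obtain ⟨n, W, q, A, hq, hA⟩ := hF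
  let b (x : BernoulliSpace G K₁) : Fin n := q (Φ x 1)
  have hb : Measurable b := hq.comp ((measurable_pi_apply 1).comp hΦ.measurable)
  have hcoord : MeasurePreserving (fun x => Φ x 1) (bernoulliMeasure G κ₁) κ₂ :=
    (measurePreserving_eval_infinitePi (fun _ : G => κ₂) 1).comp hΦ
  have hlaw : (bernoulliMeasure G κ₁).map b = κ₂.map q := by
    rw [← hcoord.map_eq, Measure.map_map hq hcoord.measurable]
    rfl
  have hcorr : (fun x => correction (A fun w => b ((w : G)⁻¹ • x)) (p (x 1)))
      =ᵐ[bernoulliMeasure G κ₁] fun x => correction (F (Φ x)) (p (x 1)) := by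
    filter_upwards [ae_all_iff.2 fun w : W => hequiv (w : G)⁻¹] with x hx
    have hbx (w : W) : b ((w : G)⁻¹ • x) = q (Φ x w) := by
      change q (Φ ((w : G)⁻¹ • x) 1) = _
      rw [hx w]
      change q (Φ x ((w : G)⁻¹⁻¹ * 1)) = _
      rw [inv_inv, mul_one]
    simp only [hbx]
    rw [hA (Φ x)]
  calc entropy (κ₁.map p) ≤ _ :=
        entropy_map_le_add_correction κ₁ hG hp hb (fun w : W => (w : G)⁻¹) A
    _ = entropy (κ₂.map q) + _ := by rw [hlaw, Measure.map_congr hcorr]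
    _ ≤ _ := by gcongr; exact entropy_map_le κ₂ hq

theorem entropy_map_le_of_isomorphic (hG : IsSofic G) (κ₁ : Measure K₁) [IsProbabilityMeasure κ₁]
    (κ₂ : Measure K₂) [IsProbabilityMeasure κ₂]
    (hiso : Isomorphic G (bernoulliMeasure G κ₁) (bernoulliMeasure G κ₂)) {T : Type*} [Finite T]
    [MeasurableSpace T] [MeasurableSingletonClass T] {p : K₁ → T} (hp : Measurable p) :
    entropy (κ₁.map p) ≤ entropy κ₂ := by
  have : Nonempty (BernoulliSpace G K₁) := nonempty_of_isProbabilityMeasure (bernoulliMeasure G κ₁)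
  have : Nonempty (BernoulliSpace G K₂) := nonempty_of_isProbabilityMeasure (bernoulliMeasure G κ₂)
  have : Nonempty T := this.map fun _ => p (Classical.arbitrary (BernoulliSpace G K₁) 1)
  obtain ⟨Φ, Ψ, hΦ, hΨ, hΨΦ, hequiv⟩ :=
    hiso.exists_measurable_maps (measurePreserving_smul_bernoulliMeasure κ₁)
  have hf : Measurable fun y => p (Ψ y 1) := hp.comp ((measurable_pi_apply 1).comp hΨ)
  obtain ⟨F, hF, hlim⟩ : ∃ F : ℕ → BernoulliSpace G K₂ → T, (∀ j, IsBlockCode (F j)) ∧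
      Tendsto (fun j => bernoulliMeasure G κ₂ {y | F j y ≠ p (Ψ y 1)}) atTop (𝓝 0) :=
    exists_seq_isBlockCode_tendsto (Measure.infinitePi fun _ : G => κ₂) hf
  have hFΦ (j : ℕ) : bernoulliMeasure G κ₁ {x | F j (Φ x) ≠ p (x 1)} =
      bernoulliMeasure G κ₂ {y | F j y ≠ p (Ψ y 1)} := by
    have hmeas : MeasurableSet {y | F j y ≠ p (Ψ y 1)} :=
      (measurableSet_eq_fun (hF j).measurable hf).compl
    rw [← hΦ.measure_preimage hmeas.nullMeasurableSet]
    refine measure_congr ?_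
    filter_upwards [hΨΦ] with x hx
    change (F j (Φ x) ≠ p (x 1)) = (F j (Φ x) ≠ p (Ψ (Φ x) 1))
    rw [hx]
  have hcorr : Tendsto (fun j => entropy ((bernoulliMeasure G κ₁).map fun x =>
      correction (F j (Φ x)) (p (x 1)))) atTop (𝓝 0) :=
    tendsto_entropy_map_correction (fun j => (hF j).measurable.comp hΦ.measurable)
      (hp.comp (measurable_pi_apply 1)) (by simpa only [hFΦ] using hlim)
  exact ge_of_tendsto' (by simpa using hcorr.const_add (entropy κ₂)) fun j =>
    entropy_map_le_add_correction_of_equivariant hG κ₁ κ₂ hΦ hequiv hp (hF j)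

theorem baseEntropy_le_of_isomorphic [MeasurableSpace.CountablySeparated K₁]
    [MeasurableSingletonClass K₂] (hG : IsSofic G) (κ₁ : Measure K₁) [IsProbabilityMeasure κ₁]
    (κ₂ : Measure K₂) [IsProbabilityMeasure κ₂]
    (hiso : Isomorphic G (bernoulliMeasure G κ₁) (bernoulliMeasure G κ₂)) :
    baseEntropy κ₁ ≤ baseEntropy κ₂ := by
  have := MeasurableSpace.measurableSingletonClass_of_countablySeparated (α := K₁)
  rw [baseEntropy_eq_entropy, baseEntropy_eq_entropy]
  exact entropy_le_of_forall_map_le κ₁ fun _ _ hp => entropy_map_le_of_isomorphic hG κ₁ κ₂ hiso hp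

end Main

end SoficEntropy

theorem theorem1_general {G : Type*} [Group G] (hG : SoficEntropy.IsSofic G)
    {K₁ K₂ : Type*} [MeasurableSpace K₁] [MeasurableSpace.CountablySeparated K₁]
    [MeasurableSpace K₂] [MeasurableSpace.CountablySeparated K₂]
    (κ₁ : Measure K₁) [IsProbabilityMeasure κ₁] (κ₂ : Measure K₂) [IsProbabilityMeasure κ₂]
    (hiso : SoficEntropy.Isomorphic G
      (SoficEntropy.bernoulliMeasure G κ₁) (SoficEntropy.bernoulliMeasure G κ₂)) :
    SoficEntropy.baseEntropy κ₁ = SoficEntropy.baseEntropy κ₂ :=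
  have := MeasurableSpace.measurableSingletonClass_of_countablySeparated (α := K₁)
  have := MeasurableSpace.measurableSingletonClass_of_countablySeparated (α := K₂)
  le_antisymm (SoficEntropy.baseEntropy_le_of_isomorphic hG κ₁ κ₂ hiso)
    (SoficEntropy.baseEntropy_le_of_isomorphic hG κ₂ κ₁ hiso.symm)

theorem theorem1 {G : Type*} [Group G] [Countable G] (hG : SoficEntropy.IsSofic G)
    {K₁ K₂ : Type*} [MeasurableSpace K₁] [StandardBorelSpace K₁]
    [MeasurableSpace K₂] [StandardBorelSpace K₂]
    (κ₁ : Measure K₁) [IsProbabilityMeasure κ₁] (κ₂ : Measure K₂) [IsProbabilityMeasure κ₂]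
    (hfin : SoficEntropy.baseEntropy κ₁ + SoficEntropy.baseEntropy κ₂ < ⊤)
    (hiso : SoficEntropy.Isomorphic G
      (SoficEntropy.bernoulliMeasure G κ₁) (SoficEntropy.bernoulliMeasure G κ₂)) :
    SoficEntropy.baseEntropy κ₁ = SoficEntropy.baseEntropy κ₂ :=
  theorem1_general hG κ₁ κ₂ hiso
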